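/- Let $\mathcal F$ be a signature, $\mathcal V$ an infinite set of variables, and $\mathcal R$ a term rewrite system (TRS), i.e. an arbitrary (possibly infinite) set of rules $l \to r$ between terms over $\mathcal F$ and $\mathcal V$; no variable conditions are imposed. A rewrite step $s \to^{\pi} t$ of $\mathcal R$ with redex pattern $\pi = \langle p, l \to r, \sigma\rangle$, $l\to r \in \mathcal R$, satisfies $s|_p = l\sigma$ and $t = s[r\sigma]_p$; read backwards it is written $t \mathrel{{}^{\pi}{\leftarrow}} s$. A conversion $\leftrightarrow^*$ is a finite sequence of steps read forwards or backwards, and $\to^=$ denotes at most one step. Let $>$ be a well-founded (strict) order and $\geqslant$ a preorder on a set of labels such that ${\geqslant}\cdot{>}\cdot{\geqslant} \subseteq {>}$. A *labeling* is a function $\ell$ from rewrite steps of $\mathcal R$ (read in either direction) to labels such that $\ell(s \to^\pi t) = \ell(t \mathrel{{}^{\pi}{\leftarrow}} s)$ and, for all contexts $C$ (with hole at position $q$), all substitutions $\tau$, and both relations $\succcurlyeq\ \in \{>, \geqslant\}$, $\ell(s \to^{\pi_1} t) \succcurlyeq \ell(u \to^{\pi_2} v)$ implies $\ell(C[s\tau]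 \to^{C[\pi_1\tau]} C[t\tau]) \succcurlyeq \ell(C[u\tau] \to^{C[\pi_2\tau]} C[v\tau])$, where $C[\pi\tau] = \langle qp, l\to r, \sigma\tau\rangle$ for $\pi = \langle p, l \to r, \sigma\rangle$. For a conversion, let $\ell(\cdot)$ be the set of labels of its steps. A local peak $t \mathrel{{}^{\pi_1}{\leftarrow}} s \to^{\pi_2} u$ with labels $\alpha = \ell(t \leftarrow s)$ and $\beta = \ell(s \to u)$ is *extended locally decreasing* (for $\ell$, $>$, $\geqslant$) if there are $t \leftrightarrow^* t' \to^= t'' \leftrightarrow^* u'' \mathrel{{}^{=}{\leftarrow}} u' \leftrightarrow^* u$ such that all labels of $t \leftrightarrow^* t'$ are $< \alpha$, the label of $t' \to^= t''$ (if any) is $\leqslant \beta$, all labels of $t'' \leftrightarrow^* u''$ are $< \alpha$ or $< \beta$, the label of $u'' \mathrel{{}^{=}{\leftarrow}} u'$ (if any) is $\leqslant \alpha$, and all labels of $u' \leftrightarrow^* u$ are $< \beta$. A local peak $t \leftarrow s \to u$ whose left step is at position $p$ and whose right step is at position $q$ with rule $l_2 \to r_2$ is a *parallel peak* if $p$ and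 $q$ are incomparable in the prefix order, and a *variable peak* if $p = qq'$ for some $q'$ that is not a function symbol position of $l_2$. The labeling $\ell$ is *compatible* with $\mathcal R$ if all parallel peaks and all variable peaks of $\mathcal R$ are extended locally decreasing. A *critical peak* is a local peak $l_2\mu[r_1\mu]_p \leftarrow l_2\mu \to r_2\mu$, with steps at position $p$ and at the root respectively, where $l_1 \to r_1$ and $l_2 \to r_2$ are variants of rules of $\mathcal R$ without common variables, $p$ is a function symbol position of $l_2$, and $\mu$ is a most general unifier of $l_1$ and $l_2|_p$; root overlaps of a rule with a variant of itself are not excluded. Here the variants are images of rules of $\mathcal R$ under injective maps $\rho_1, \rho_2 : \mathcal V \to \mathcal V$ with disjoint ranges, and as steps of $\mathcal R$ the two steps use the original rules with the substitutions $x \mapsto (\rho_1 x)\mu$ and $x \mapsto (\rho_2 x)\mu$. **Corollary.** Let $\ell$ be a labeling that is compatible with $\mathcal R$. If all critical peaks of $\mathcal R$ are extended locally decreasing for $\ell$, $>$ and $\geqslant$, then $\mathcal R$ is confluent, i.e. whenever $s \to_{\mathcal R}^* t$ and $s \to_{\mathcal R}^* u$ there is $v$ with $t \to_{\mathcal R}^*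 v$ and $u \to_{\mathcal R}^* v$. -/

import Mathlib

universe u v w x

namespace Rewriting

open FirstOrder.Language

/-! ### Terms, positions, substitutions, contexts

Terms over a signature `L` and variables `V` are Mathlib's first-order terms `L.Term V` (the relation
symbols of `L` play no role), and `t.subst σ` is the application of a substitution.
Positions are finite strings of numbers; arguments are numbered from `0`. -/

/-- `subtermAt t p` is the subterm of `t` at position `p`, or `none` if `p` is not a position
of `t`. -/
def subtermAt {L : FirstOrder.Language.{u, v}} {V : Type w} : L.Term V → List ℕ → Option (L.Term V)
  | t, [] => some t
  | .var _, _ :: _ => none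
  | @Term.func _ _ l _ ts, i :: p => if h : i < l then subtermAt (ts ⟨i, h⟩) p else none

/-- `replaceAt t p u` is the term `t[u]_p` (only used when `p` is a position of `t`). -/
def replaceAt {L : FirstOrder.Language.{u, v}} {V : Type w} : L.Term V → List ℕ → L.Term V → L.Term V
  | _, [], u => u
  | .var y, _ :: _, _ => .var y
  | .func f ts, i :: p, u =>
      .func f (fun j => if (j : ℕ) = i then replaceAt (ts j) p u else ts j)

/-- `p` is a function symbol position of `t`. -/
def IsFunPos {L : FirstOrder.Language.{u, v}} {V : Type w} (t : L.Term V) (p : List ℕ) : Prop :=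
  ∃ (l : ℕ) (f : L.Functions l) (ts : Fin l → L.Term V), subtermAt t p = some (.func f ts)

/-- The composition of substitutions: first `σ`, then `τ`. -/
def substComp {L : FirstOrder.Language.{u, v}} {V : Type w} (σ τ : V → L.Term V) : V → L.Term V :=
  fun y => (σ y).subst τ

/-- Contexts: terms with exactly one hole. In `func f ts i C` the hole is inside the `i`-th argument,
which is `C`; the entry `ts i` is disregarded. -/
inductive Ctx (L : FirstOrder.Language.{u, v}) (V : Type w) : Type (max u w)
  | hole : Ctx L V
  | func {l : ℕ} (f : L.Functions l) (ts : Fin l → L.Term V) (i : Fin l) (C : Ctx L V) : Ctx L V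

/-- `C.fill t` is `C[t]`. -/
def Ctx.fill {L : FirstOrder.Language.{u, v}} {V : Type w} : Ctx L V → L.Term V → L.Term V
  | .hole, t => t
  | .func f ts i C, t => .func f (Function.update ts i (C.fill t))

/-- The position of the hole. -/
def Ctx.holePos {L : FirstOrder.Language.{u, v}} {V : Type w} : Ctx L V → List ℕ
  | .hole => []
  | .func _ _ i C => (i : ℕ) :: C.holePos

theorem subst_subst {L : FirstOrder.Language.{u, v}} {V : Type w} (t : L.Term V) (σ τ : V → L.Term V) :
    (t.subst σ).subst τ = t.subst (substComp σ τ) := by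
  induction t with
  | var _ => rfl
  | func f ts ih => simp only [Term.subst]; congr 1; funext i; exact ih i

theorem subtermAt_subst {L : FirstOrder.Language.{u, v}} {V : Type w} (σ : V → L.Term V) :
    ∀ (t : L.Term V) (p : List ℕ) (s : L.Term V), subtermAt t p = some s →
      subtermAt (t.subst σ) p = some (s.subst σ)
  | t, [], s, h => by
      have : t = s := by cases t <;> simpa [subtermAt] using h
      subst this
      simp [subtermAt]
  | .var _, _ :: _, _, h => by simp [subtermAt] at h
  | @Term.func _ _ l f ts, i :: p, s, h => by
      by_cases hi : i < l
      · simp only [subtermAt, hi, dif_pos] at h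
        simp only [Term.subst, subtermAt, hi, dif_pos]
        exact subtermAt_subst σ _ p s h
      · simp [subtermAt, hi] at h

theorem replaceAt_subst {L : FirstOrder.Language.{u, v}} {V : Type w} (σ : V → L.Term V) :
    ∀ (t : L.Term V) (p : List ℕ) (r s : L.Term V), subtermAt t p = some s →
      (replaceAt t p r).subst σ = replaceAt (t.subst σ) p (r.subst σ)
  | t, [], r, s, _ => by simp [replaceAt]
  | .var _, _ :: _, _, _, h => by simp [subtermAt] at h
  | @Term.func _ _ l f ts, i :: p, r, s, h => by
      by_cases hi : i < l
      · simp only [subtermAt, hi, dif_pos] at h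
        simp only [Term.subst, replaceAt]
        congr 1
        funext j
        by_cases hj : (j : ℕ) = i
        · have hj' : j = ⟨i, hi⟩ := Fin.ext hj
          subst hj'
          simp only [if_true]
          exact replaceAt_subst σ _ p r s h
        · simp [hj]
      · simp [subtermAt, hi] at h

theorem subtermAt_fill {L : FirstOrder.Language.{u, v}} {V : Type w} (C : Ctx L V) (t : L.Term V)
    (p : List ℕ) : subtermAt (C.fill t) (C.holePos ++ p) = subtermAt t p := by
  induction C with
  | hole => rfl
  | func f ts i C ih => simp [Ctx.fill, Ctx.holePos, subtermAt, ih]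

theorem replaceAt_fill {L : FirstOrder.Language.{u, v}} {V : Type w} (C : Ctx L V) (t r : L.Term V)
    (p : List ℕ) : replaceAt (C.fill t) (C.holePos ++ p) r = C.fill (replaceAt t p r) := by
  induction C with
  | hole => rfl
  | func f ts i C ih =>
      simp only [Ctx.fill, Ctx.holePos, List.cons_append, replaceAt]
      congr 1
      funext j
      by_cases hj : j = i
      · subst hj; simp [ih]
      · have hj' : (j : ℕ) ≠ i := fun h => hj (Fin.ext h)
        simp [hj, hj']

/-! ### Term rewrite systems -/

/-- A rewrite rule is an arbitrary pair of terms; no variable conditions are imposed. A term rewrite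
system is a set of rules. -/
@[ext]
structure Rule (L : FirstOrder.Language.{u, v}) (V : Type w) : Type (max u w) where
  lhs : L.Term V
  rhs : L.Term V

/-- The rewrite relation of `R`: the smallest relation that contains `R` and is closed under
substitutions and contexts. -/
inductive Rewrites {L : FirstOrder.Language.{u, v}} {V : Type w} (R : Set (Rule L V)) :
    L.Term V → L.Term V → Prop
  | rule (ρ : Rule L V) : ρ ∈ R → Rewrites R ρ.lhs ρ.rhs
  | subst (σ : V → L.Term V) {s t : L.Term V} : Rewrites R s t →
      Rewrites R (s.subst σ) (t.subst σ)
  | ctx (C : Ctx L V) {s t : L.Term V} : Rewrites R s t → Rewrites R (C.fill s) (C.fill t)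

/-- Confluence of the term rewrite system `R`. -/
def Confluent {L : FirstOrder.Language.{u, v}} {V : Type w} (R : Set (Rule L V)) : Prop :=
  ∀ s t u : L.Term V, Relation.ReflTransGen (Rewrites R) s t →
    Relation.ReflTransGen (Rewrites R) s u →
    ∃ z, Relation.ReflTransGen (Rewrites R) t z ∧ Relation.ReflTransGen (Rewrites R) u z

/-- A rewrite step of `R`: a source term together with a redex pattern
`⟨pos, rule, sub⟩` that matches it. -/
@[ext]
structure Step {L : FirstOrder.Language.{u, v}} {V : Type w} (R : Set (Rule L V)) : Type (max u w) where
  source : L.Term V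
  pos : List ℕ
  rule : Rule L V
  sub : V → L.Term V
  rule_mem : rule ∈ R
  source_at : subtermAt source pos = some (rule.lhs.subst sub)

/-- The target `s[rσ]_p` of a step. -/
def Step.target {L : FirstOrder.Language.{u, v}} {V : Type w} {R : Set (Rule L V)} (e : Step R) : L.Term V :=
  replaceAt e.source e.pos (e.rule.rhs.subst e.sub)

/-- The instance `C[sσ] → C[tσ]` of the step `s → t`, with redex pattern
`⟨q p, l → r, τσ⟩` where `q` is the position of the hole of `C`. -/
def Step.inst {L : FirstOrder.Language.{u, v}} {V : Type w} {R : Set (Rule L V)} (e : Step R) (C : Ctx L V)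
    (σ : V → L.Term V) : Step R where
  source := C.fill (e.source.subst σ)
  pos := C.holePos ++ e.pos
  rule := e.rule
  sub := substComp e.sub σ
  rule_mem := e.rule_mem
  source_at := by
    rw [subtermAt_fill, subtermAt_subst σ _ _ _ e.source_at, subst_subst]

theorem Step.inst_target {L : FirstOrder.Language.{u, v}} {V : Type w} {R : Set (Rule L V)} (e : Step R)
    (C : Ctx L V) (σ : V → L.Term V) : (e.inst C σ).target = C.fill (e.target.subst σ) := by
  simp only [Step.target, Step.inst]
  rw [replaceAt_fill, replaceAt_subst σ _ _ _ _ e.source_at, subst_subst]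

/-- A rewrite step read in one of the two directions: `s → t` or `t ← s`. -/
inductive OStep {L : FirstOrder.Language.{u, v}} {V : Type w} (R : Set (Rule L V)) : Type (max u w)
  | fwd (e : Step R) : OStep R
  | bwd (e : Step R) : OStep R

def OStep.src {L : FirstOrder.Language.{u, v}} {V : Type w} {R : Set (Rule L V)} : OStep R → L.Term V
  | .fwd e => e.source
  | .bwd e => e.target

def OStep.tgt {L : FirstOrder.Language.{u, v}} {V : Type w} {R : Set (Rule L V)} : OStep R → L.Term V
  | .fwd e => e.target
  | .bwd e => e.source

/-- `IsConversion R s c t`: the list `c` of oriented steps is a conversion from `s` to `t`. -/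
inductive IsConversion {L : FirstOrder.Language.{u, v}} {V : Type w} (R : Set (Rule L V)) :
    L.Term V → List (OStep R) → L.Term V → Prop
  | nil (s : L.Term V) : IsConversion R s [] s
  | cons (o : OStep R) {c : List (OStep R)} {t : L.Term V} :
      IsConversion R o.tgt c t → IsConversion R o.src (o :: c) t

/-- A list with at most one element that is a forward rewrite sequence from `s` to `t`
(a step of the reflexive closure of the rewrite relation). -/
def IsForwardOpt {L : FirstOrder.Language.{u, v}} {V : Type w} (R : Set (Rule L V))
    (s : L.Term V) (c : List (OStep R)) (t : L.Term V) : Prop :=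
  (c = [] ∧ s = t) ∨ ∃ e : Step R, c = [.fwd e] ∧ e.source = s ∧ e.target = t

/-- The same for a backward step from `s` to `t`, i.e. `s ← t`. -/
def IsBackwardOpt {L : FirstOrder.Language.{u, v}} {V : Type w} (R : Set (Rule L V))
    (s : L.Term V) (c : List (OStep R)) (t : L.Term V) : Prop :=
  (c = [] ∧ s = t) ∨ ∃ e : Step R, c = [.bwd e] ∧ e.target = s ∧ e.source = t

/-! ### Local peaks -/

/-- A local peak `t ← s → u`: two steps with the same source, `left : s → t` and
`right : s → u`. -/
structure LocalPeak {L : FirstOrder.Language.{u, v}} {V : Type w} (R : Set (Rule L V)) :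
    Type (max u w) where
  left : Step R
  right : Step R
  source_eq : left.source = right.source

/-- The two positions are incomparable in the prefix order. -/
def LocalPeak.IsParallel {L : FirstOrder.Language.{u, v}} {V : Type w} {R : Set (Rule L V)}
    (P : LocalPeak R) : Prop :=
  ¬ P.left.pos <+: P.right.pos ∧ ¬ P.right.pos <+: P.left.pos

/-- The left step takes place at or below the position of the right step, but not at a
function symbol position of the left-hand side of the rule of the right step. -/
def LocalPeak.IsVariable {L : FirstOrder.Language.{u, v}} {V : Type w} {R : Set (Rule L V)}
    (P : LocalPeak R) : Prop :=
  ∃ q : List ℕ, P.left.pos = P.right.pos ++ q ∧ ¬ IsFunPos P.right.rule.lhs q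

/-- `μ` is a most general unifier of `s` and `t`. -/
def IsMGU {L : FirstOrder.Language.{u, v}} {V : Type w} (μ : V → L.Term V) (s t : L.Term V) : Prop :=
  s.subst μ = t.subst μ ∧
    ∀ τ : V → L.Term V, s.subst τ = t.subst τ → ∃ θ : V → L.Term V, τ = substComp μ θ

/-- Critical peaks `l₂μ[r₁μ]_p ← l₂μ → r₂μ` of `R`. The variants without common variables of the
two rules are their images under injective renamings `ρ₁`, `ρ₂` with disjoint ranges, `p` is a
function symbol position of `l₂`, and `μ` is a most general unifier of the renamed `l₁` and the
subterm at `p` of the renamed `l₂`. As steps of `R`, the left step applies the first rule at `p` with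
the substitution `y ↦ μ (ρ₁ y)`, and the right step the second rule at the root with
`y ↦ μ (ρ₂ y)`. Overlaps of a rule with itself at the root are not excluded. -/
def LocalPeak.IsCritical {L : FirstOrder.Language.{u, v}} {V : Type w} {R : Set (Rule L V)}
    (P : LocalPeak R) : Prop :=
  ∃ (ρ₁ ρ₂ : V → V) (μ : V → L.Term V) (s : L.Term V),
    Function.Injective ρ₁ ∧ Function.Injective ρ₂ ∧
    Disjoint (Set.range ρ₁) (Set.range ρ₂) ∧
    IsFunPos P.right.rule.lhs P.left.pos ∧
    subtermAt (P.right.rule.lhs.relabel ρ₂) P.left.pos = some s ∧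
    IsMGU μ (P.left.rule.lhs.relabel ρ₁) s ∧
    P.right.pos = [] ∧
    P.left.sub = (fun y => μ (ρ₁ y)) ∧ P.right.sub = (fun y => μ (ρ₂ y))

/-! ### Labelings and extended local decreasingness -/

/-- A labeling (for the relations `gt` and `ge` on labels): a function from oriented rewrite steps to
labels that ignores the direction, such that `gt` and `ge` between labels of steps are preserved
by contexts and substitutions. -/
structure IsLabeling {L : FirstOrder.Language.{u, v}} {V : Type w} {R : Set (Rule L V)} {Λ : Type x}
    (gt ge : Λ → Λ → Prop) (lab : OStep R → Λ) : Prop where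
  gt_inst : ∀ (e₁ e₂ : Step R) (C : Ctx L V) (σ : V → L.Term V),
    gt (lab (.fwd e₁)) (lab (.fwd e₂)) →
      gt (lab (.fwd (e₁.inst C σ))) (lab (.fwd (e₂.inst C σ)))
  ge_inst : ∀ (e₁ e₂ : Step R) (C : Ctx L V) (σ : V → L.Term V),
    ge (lab (.fwd e₁)) (lab (.fwd e₂)) →
      ge (lab (.fwd (e₁.inst C σ))) (lab (.fwd (e₂.inst C σ)))
  fwd_eq_bwd : ∀ e : Step R, lab (.fwd e) = lab (.bwd e)

/-- The set of labels of a conversion. -/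
def labels {L : FirstOrder.Language.{u, v}} {V : Type w} {R : Set (Rule L V)} {Λ : Type x}
    (lab : OStep R → Λ) (c : List (OStep R)) : Set Λ :=
  {α | ∃ o ∈ c, lab o = α}

/-- The set of all `β` with `α ≻ β` for some `α ∈ S`. -/
def below {Λ : Type x} (r : Λ → Λ → Prop) (S : Set Λ) : Set Λ :=
  {β | ∃ α ∈ S, r α β}

/-- The local peak `t ← s → u` is extended locally decreasing: there is a local diagram
`t ↔* t' →⁼ t'' ↔* u'' ←⁼ u' ↔* u` with suitably bounded labels. -/
def LocalPeak.IsELD {L : FirstOrder.Language.{u, v}} {V : Type w} {R : Set (Rule L V)} {Λ : Type x}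
    (gt ge : Λ → Λ → Prop) (lab : OStep R → Λ) (P : LocalPeak R) : Prop :=
  ∃ (t' t'' u'' u' : L.Term V) (c₁ c₂ c₃ c₄ c₅ : List (OStep R)),
    IsConversion R P.left.target c₁ t' ∧
    IsForwardOpt R t' c₂ t'' ∧
    IsConversion R t'' c₃ u'' ∧
    IsBackwardOpt R u'' c₄ u' ∧
    IsConversion R u' c₅ P.right.target ∧
    labels lab c₁ ⊆ below gt (labels lab [.bwd P.left]) ∧
    labels lab c₂ ⊆ below ge (labels lab [.fwd P.right]) ∧
    labels lab c₃ ⊆ below gt (labels lab [.bwd P.left, .fwd P.right]) ∧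
    labels lab c₄ ⊆ below ge (labels lab [.bwd P.left]) ∧
    labels lab c₅ ⊆ below gt (labels lab [.fwd P.right])

/-- The labeling `lab` is compatible with `R`: all parallel peaks and all variable peaks of `R` are
extended locally decreasing. -/
def IsCompatible {L : FirstOrder.Language.{u, v}} {V : Type w} {R : Set (Rule L V)} {Λ : Type x}
    (gt ge : Λ → Λ → Prop) (lab : OStep R → Λ) : Prop :=
  ∀ P : LocalPeak R, P.IsParallel ∨ P.IsVariable → P.IsELD gt ge lab

end Rewriting

/-! The proof uses van Oostrom's decreasing diagrams, with labels replaced by their ordinal ranks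
under `gt`. A `gt` comparison strictly lowers the rank and, by compatibility of the two relations, a
`ge` comparison never raises it. A step receives as index every ordinal at or above the rank of its
label (`StepRank`). Extended local decreasingness thus becomes ordinary local decreasingness over a
linear well-order, where "below one of the two labels" means "below the maximum".

Up to mirroring, every local peak is a parallel peak, a variable peak, or an instance of a critical
peak (`LocalPeak.exists_critical`, resting on `exists_isMGU`). Labelings preserve comparisons under
contexts and substitutions, so the diagram of a critical peak serves all its instances.

The abstract core is `projects`, by well-founded induction on an index `c`: a conversion below `c`
is turned into two joining reductions below `c`, while one optional step of index at least `c` on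
each side is carried along. A peak of reductions is a finite conversion, hence lies below some
ordinal, and is therefore joinable. -/

namespace Rewriting

/-! ### Decreasing diagrams for relations indexed by a well-ordered set -/

section DecreasingDiagrams

open Relation

variable {A : Type*} {O : Type*} [LinearOrder O]

/-- The union of the relations with index below `c`. -/
def StepBelow (r : O → A → A → Prop) (c : O) (a b : A) : Prop :=
  ∃ d < c, r d a b

/-- Convertibility by steps with index below `c`. -/
def ConvBelow (r : O → A → A → Prop) (c : O) : A → A → Prop :=
  ReflTransGen (SymmGen (StepBelow r c))

/-- Reachability by steps with index below `c`. -/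
def RedBelow (r : O → A → A → Prop) (c : O) : A → A → Prop :=
  ReflTransGen (StepBelow r c)

/-- The points `t` and `u` are connected by a decreasing diagram, where `t` has been reached by a
step with index `a` and `u` by a step with index `b`. -/
def DecreasingJoin (r : O → A → A → Prop) (a b : O) (t u : A) : Prop :=
  ∃ p q q' u', ConvBelow r a t p ∧ ReflGen (r b) p q ∧ ConvBelow r (max a b) q q' ∧
    ReflGen (r a) u' q' ∧ ConvBelow r b u' u

variable {r : O → A → A → Prop}

theorem ConvBelow.refl (c : O) (a : A) : ConvBelow r c a a := ReflTransGen.refl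

theorem ConvBelow.symm {c : O} {a b : A} (h : ConvBelow r c a b) : ConvBelow r c b a :=
  ReflTransGen.stdSymm.symm _ _ h

theorem ConvBelow.trans {c : O} {a b d : A} (h : ConvBelow r c a b) (h' : ConvBelow r c b d) :
    ConvBelow r c a d :=
  ReflTransGen.trans h h'

theorem StepBelow.mono {c d : O} (hcd : c ≤ d) {a b : A} (h : StepBelow r c a b) :
    StepBelow r d a b :=
  h.imp fun _ h => ⟨h.1.trans_le hcd, h.2⟩

theorem ConvBelow.mono {c d : O} (hcd : c ≤ d) {a b : A} (h : ConvBelow r c a b) :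
    ConvBelow r d a b :=
  ReflTransGen.mono (fun _ _ => Or.imp (StepBelow.mono hcd) (StepBelow.mono hcd)) _ _ h

theorem RedBelow.mono {c d : O} (hcd : c ≤ d) {a b : A} (h : RedBelow r c a b) :
    RedBelow r d a b :=
  ReflTransGen.mono (fun _ _ => StepBelow.mono hcd) _ _ h

theorem RedBelow.convBelow {c : O} {a b : A} (h : RedBelow r c a b) : ConvBelow r c a b :=
  ReflTransGen.mono (fun _ _ => Or.inl) _ _ h

theorem DecreasingJoin.symm {a b : O} {t u : A} (h : DecreasingJoin r a b t u) :
    DecreasingJoin r b a u t := by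
  obtain ⟨p, q, q', u', h₁, h₂, h₃, h₄, h₅⟩ := h
  exact ⟨u', q', q, p, h₅.symm, h₄, max_comm a b ▸ h₃.symm, h₂, h₁.symm⟩

theorem convBelow_of_reflGen {c d : O} (hcd : c < d) {a b : A} (h : ReflGen (r c) a b) :
    ConvBelow r d a b := by
  cases h with
  | refl => exact .refl _ _
  | single h => exact ReflTransGen.single (Or.inl ⟨c, hcd, h⟩)

/-- Any two optional steps with indices at least `c` that start at points convertible below `c`
have projections that start at a common reduct. -/
def Projects (r : O → A → A → Prop) (c : O) : Prop :=
  ∀ f₁ f₂, c ≤ f₁ → c ≤ f₂ → ∀ x₁ x₂ t₁ t₂, ConvBelow r c x₁ x₂ → ReflGen (r f₁) x₁ t₁ →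
    ReflGen (r f₂) x₂ t₂ → ∃ z t₁' t₂', RedBelow r c x₁ z ∧ RedBelow r c x₂ z ∧
      ReflGen (r f₁) z t₁' ∧ ConvBelow r f₁ t₁' t₁ ∧ ReflGen (r f₂) z t₂' ∧ ConvBelow r f₂ t₂' t₂

/-- At most one step with index `b`, modulo convertibility below `b`. -/
def StepModulo (r : O → A → A → Prop) (b : O) (x y : A) : Prop :=
  ∃ x' y', ConvBelow r b x x' ∧ ReflGen (r b) x' y' ∧ ConvBelow r b y' y

/-- The two `b`-steps start at points that are only convertible below `b`. Projecting both onto a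
common source produces a genuine local peak, and its decreasing diagram, with equal indices, is a
diamond modulo convertibility below `b`. -/
theorem StepModulo.diamond (hr : ∀ a b s t u, r a s t → r b s u → DecreasingJoin r a b t u) {b : O}
    (hb : Projects r b) {x y₁ y₂ : A} (h₁ : StepModulo r b x y₁) (h₂ : StepModulo r b x y₂) :
    ∃ w, StepModulo r b y₁ w ∧ StepModulo r b y₂ w := by
  obtain ⟨x₁, z₁, hx₁, hs₁, hz₁⟩ := h₁
  obtain ⟨x₂, z₂, hx₂, hs₂, hz₂⟩ := h₂
  obtain ⟨z, t₁, t₂, -, -, ht₁, hc₁, ht₂, hc₂⟩ :=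
    hb b b le_rfl le_rfl x₁ x₂ z₁ z₂ (hx₁.symm.trans hx₂) hs₁ hs₂
  have e₁ := (hc₁.trans hz₁).symm
  have e₂ := (hc₂.trans hz₂).symm
  cases ht₁ with
  | refl => exact ⟨t₂, ⟨_, _, e₁, ht₂, .refl _ _⟩, ⟨_, _, e₂, .refl, .refl _ _⟩⟩
  | single h₁ =>
    cases ht₂ with
    | refl => exact ⟨t₁, ⟨_, _, e₁, .refl, .refl _ _⟩, ⟨_, _, e₂, .single h₁, .refl _ _⟩⟩
    | single h₂ =>
      obtain ⟨p, q, q', u', k₁, k₂, k₃, k₄, k₅⟩ := hr _ _ _ _ _ h₁ h₂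
      rw [max_self] at k₃
      exact ⟨q, ⟨_, _, e₁.trans k₁, k₂, .refl _ _⟩, ⟨_, _, e₂.trans k₅.symm, k₄, k₃.symm⟩⟩

/-- Transports a step of index `f` along reductions modulo lower conversions, replacing these by
genuine reductions below `c`. The end `v` is then met only up to convertibility below `b`, and the
target of the step only up to convertibility below `f`. -/
theorem Projects.along (hr : ∀ a b s t u, r a s t → r b s u → DecreasingJoin r a b t u) {b c f : O}
    (hb : Projects r b) (hbc : b < c) (hcf : c ≤ f) {x₀ v : A}
    (h : ReflTransGen (StepModulo r b) x₀ v) :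
    ∀ x t, ConvBelow r b x x₀ → ReflGen (r f) x t →
      ∃ v' t', RedBelow r c x v' ∧ ConvBelow r b v' v ∧ ReflGen (r f) v' t' ∧
        ConvBelow r f t' t := by
  have hbf : b < f := hbc.trans_le hcf
  induction h using ReflTransGen.head_induction_on with
  | refl => exact fun x t hx ht => ⟨x, t, .refl, hx, ht, .refl _ _⟩
  | head hstep _ ih =>
    rename_i x₀ y
    intro x t hx ht
    obtain ⟨x', y', hx', hs, hy⟩ := hstep
    obtain ⟨z, t₁, y₁, hxz, -, hz₁, ht₁, hz₂, hy₁⟩ :=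
      hb f b hbf.le le_rfl x x' t y' (hx.trans hx') ht hs
    -- The optional `f`-step is moved across the `b`-step: it now starts at a point convertible to
    -- `y₁` below `b`. Since `b < f`, the `b`-step on the far side of the diagram is absorbed into
    -- the conversion below `f`.
    have key : ∃ p q, ConvBelow r b y₁ p ∧ ReflGen (r f) p q ∧ ConvBelow r f q t₁ := by
      cases hz₁ with
      | refl => exact ⟨y₁, y₁, .refl _ _, .refl, (convBelow_of_reflGen hbf hz₂).symm⟩
      | single h₁ =>
        cases hz₂ with
        | refl => exact ⟨z, t₁, .refl _ _, .single h₁, .refl _ _⟩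
        | single h₂ =>
          obtain ⟨p, q, q', u', k₁, k₂, k₃, k₄, k₅⟩ := hr _ _ _ _ _ h₁ h₂
          rw [max_eq_left hbf.le] at k₃
          exact ⟨u', q', k₅.symm, k₄,
            ((k₁.trans (convBelow_of_reflGen hbf k₂)).trans k₃).symm⟩
    obtain ⟨p, q, hp, hpq, hq⟩ := key
    obtain ⟨z', -, q₁, hz', -, -, -, hq₁, hqq⟩ :=
      hb b f le_rfl hbf.le y₁ p y₁ q hp .refl hpq
    have hzy : RedBelow r c z y₁ := by
      cases hz₂ with
      | refl => exact .refl
      | single h => exact .single ⟨b, hbc, h⟩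
    obtain ⟨v', t', h₁, h₂, h₃, h₄⟩ :=
      ih z' q₁ ((hz'.convBelow.symm.trans hy₁).trans hy) hq₁
    exact ⟨v', t', (((hxz.mono hbc.le).trans hzy).trans (hz'.mono hbc.le)).trans h₁, h₂, h₃,
      ((h₄.trans hqq).trans hq).trans ht₁⟩

/-- The finitely many indices of a nonempty conversion have a maximum, still below `c`. This
supplies the smaller index for the induction, even when `c` is a limit. -/
theorem ConvBelow.eq_or_exists {c : O} {x y : A} (h : ConvBelow r c x y) :
    x = y ∨ ∃ b < c, ReflTransGen (fun x y => ∃ d ≤ b, SymmGen (r d) x y) x y := by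
  induction h with
  | refl => exact .inl rfl
  | tail _ hs ih =>
    obtain ⟨d, hd, hs⟩ : ∃ d < c, SymmGen (r d) _ _ := by
      rcases hs with ⟨d, hd, hs⟩ | ⟨d, hd, hs⟩
      exacts [⟨d, hd, .inl hs⟩, ⟨d, hd, .inr hs⟩]
    rcases ih with rfl | ⟨b, hb, hxy⟩
    · exact .inr ⟨d, hd, .single ⟨d, le_rfl, hs⟩⟩
    · refine .inr ⟨max b d, max_lt hb hd, (ReflTransGen.mono ?_ _ _ hxy).tail
        ⟨d, le_max_right _ _, hs⟩⟩
      exact fun _ _ ⟨e, he, h⟩ => ⟨e, he.trans (le_max_left _ _), h⟩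

/-- With `b` the top index of the conversion, the diamond property makes `StepModulo r b` confluent,
so `x₁` and `x₂` have a common reduct `v` modulo conversions below `b`. Both optional steps are
transported towards `v`. -/
theorem projects (hwf : WellFounded ((· < ·) : O → O → Prop))
    (hr : ∀ a b s t u, r a s t → r b s u → DecreasingJoin r a b t u) (c : O) : Projects r c := by
  induction c using hwf.induction with
  | _ c ih =>
  intro f₁ f₂ hf₁ hf₂ x₁ x₂ t₁ t₂ hx h₁ h₂
  rcases hx.eq_or_exists with rfl | ⟨b, hbc, hb⟩
  · exact ⟨x₁, t₁, t₂, .refl, .refl, h₁, .refl _ _, h₂, .refl _ _⟩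
  have hconv : ∀ {d x y}, d ≤ b → r d x y → StepModulo r b x y := by
    intro d x y hd h
    rcases hd.lt_or_eq with hd | rfl
    · exact ⟨y, y, .single (.inl ⟨d, hd, h⟩), .refl, .refl _ _⟩
    · exact ⟨x, y, .refl _ _, .single h, .refl _ _⟩
  have hcr : ∀ {x y z}, ReflTransGen (StepModulo r b) x y → ReflTransGen (StepModulo r b) x z →
      Join (ReflTransGen (StepModulo r b)) y z :=
    church_rosser fun _ _ _ h h' =>
      (StepModulo.diamond hr (ih b hbc) h h').imp fun _ h => ⟨.single h.1, .single h.2⟩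
  have hjoin : ∀ {y}, ReflTransGen (fun x y => ∃ d ≤ b, SymmGen (r d) x y) x₁ y →
      Join (ReflTransGen (StepModulo r b)) x₁ y := by
    intro y hy
    induction hy with
    | refl => exact ⟨x₁, .refl, .refl⟩
    | tail _ hs ih =>
      obtain ⟨v, hv₁, hv₂⟩ := ih
      obtain ⟨d, hd, hs | hs⟩ := hs
      · obtain ⟨w, hw₁, hw₂⟩ := hcr hv₂ (.single (hconv hd hs))
        exact ⟨w, hv₁.trans hw₁, hw₂⟩
      · exact ⟨v, hv₁, .head (hconv hd hs) hv₂⟩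
  obtain ⟨v, hv₁, hv₂⟩ := hjoin hb
  obtain ⟨v₁, s₁, a₁, a₂, a₃, a₄⟩ := (ih b hbc).along hr hbc hf₁ hv₁ x₁ t₁ (.refl _ _) h₁
  obtain ⟨v₂, s₂, b₁, b₂, b₃, b₄⟩ := (ih b hbc).along hr hbc hf₂ hv₂ x₂ t₂ (.refl _ _) h₂
  -- `v₁` and `v₂` agree with `v` only up to convertibility below `b`; one more use of the induction
  -- hypothesis merges them.
  obtain ⟨z, t₁', t₂', k₁, k₂, k₃, k₄, k₅, k₆⟩ := ih b hbc f₁ f₂ (hbc.le.trans hf₁)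
    (hbc.le.trans hf₂) v₁ v₂ s₁ s₂ (a₂.trans b₂.symm) a₃ b₃
  exact ⟨z, t₁', t₂', a₁.trans (k₁.mono hbc.le), b₁.trans (k₂.mono hbc.le), k₃, k₄.trans a₄,
    k₅, k₆.trans b₄⟩

/-- Local decreasingness implies the Church-Rosser property. -/
theorem joinable_of_convBelow (hwf : WellFounded ((· < ·) : O → O → Prop))
    (hr : ∀ a b s t u, r a s t → r b s u → DecreasingJoin r a b t u) {c : O} {x y : A}
    (h : ConvBelow r c x y) : ∃ z, RedBelow r c x z ∧ RedBelow r c y z := by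
  obtain ⟨z, -, -, h₁, h₂, -⟩ :=
    projects hwf hr c c c le_rfl le_rfl x y x y h .refl .refl
  exact ⟨z, h₁, h₂⟩

end DecreasingDiagrams

/-! ### Unification -/

section Unification

open FirstOrder.Language

variable {L : FirstOrder.Language.{u, v}} {V : Type w}

theorem subst_var (t : L.Term V) : t.subst Term.var = t := by
  induction t with
  | var _ => rfl
  | func f ts ih => simp only [Term.subst]; congr 1; funext i; exact ih i

theorem relabel_subst {W : Type*} (t : L.Term V) (ρ : V → W) (σ : W → L.Term W) :
    (t.relabel ρ).subst σ = t.subst (fun y => σ (ρ y)) := by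
  induction t with
  | var _ => rfl
  | func f ts ih => simp only [Term.relabel, Term.subst]; congr 1; funext i; exact ih i

/-- The number of symbols of a term. -/
def termSize : L.Term V → ℕ
  | .var _ => 1
  | .func _ ts => 1 + ∑ i, termSize (ts i)

theorem termSize_lt_func {l : ℕ} (f : L.Functions l) (ts : Fin l → L.Term V) (i : Fin l) :
    termSize (ts i) < termSize (.func f ts) := by
  have := Finset.single_le_sum (f := fun i => termSize (ts i)) (fun _ _ => Nat.zero_le _)
    (Finset.mem_univ i)
  simp only [termSize]
  omega

/-- Two terms are identified if every unifier of `s` and `t` maps them to the same term. -/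
def Identified (s t a b : L.Term V) : Prop :=
  ∀ τ : V → L.Term V, s.subst τ = t.subst τ → a.subst τ = b.subst τ

open Classical in
/-- An element of `S`, a non-variable one if possible. -/
noncomputable def pickTerm [Nonempty (L.Term V)] (S : Set (L.Term V)) : L.Term V :=
  if h : ∃ l, ∃ (f : L.Functions l) (ts : Fin l → L.Term V), .func f ts ∈ S then
    .func h.choose_spec.choose h.choose_spec.choose_spec.choose
  else Classical.epsilon (· ∈ S)

theorem pickTerm_mem [Nonempty (L.Term V)] {S : Set (L.Term V)} (hS : S.Nonempty) :
    pickTerm S ∈ S := by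
  unfold pickTerm
  split_ifs with h
  · exact h.choose_spec.choose_spec.choose_spec
  · exact Classical.epsilon_spec (p := (· ∈ S)) hS

theorem exists_pickTerm_eq_func [Nonempty (L.Term V)] {S : Set (L.Term V)} {l : ℕ}
    {f : L.Functions l} {ts : Fin l → L.Term V} (h : .func f ts ∈ S) :
    ∃ l', ∃ (g : L.Functions l') (us : Fin l' → L.Term V), pickTerm S = .func g us := by
  have h' : ∃ l, ∃ (f : L.Functions l) (ts : Fin l → L.Term V), .func f ts ∈ S := ⟨l, f, ts, h⟩
  unfold pickTerm
  rw [dif_pos h']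
  exact ⟨_, _, _, rfl⟩

/-- A most general unifier of `s` and `t`, defined by recursion along the sizes of the values of a
unifier `τ`: variables are replaced by a representative of their class of identified terms. -/
noncomputable def unifier (s t : L.Term V) (τ : V → L.Term V) (y : V) : L.Term V :=
  haveI : Nonempty (L.Term V) := ⟨s⟩
  match pickTerm {b | Identified s t (.var y) b} with
  | .var z => .var z
  | .func f ts => .func f fun i => (ts i).subst fun z =>
      if termSize (τ z) < termSize (τ y) then unifier s t τ z else .var z
termination_by termSize (τ y)

theorem subst_ite_of_termSize_lt (τ μ : V → L.Term V) (n : ℕ) (a : L.Term V)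
    (ha : termSize (a.subst τ) < n) :
    a.subst (fun z => if termSize (τ z) < n then μ z else .var z) = a.subst μ := by
  induction a with
  | var z => exact if_pos ha
  | func f ts ih =>
    simp only [Term.subst] at ha ⊢
    congr 1
    funext i
    exact ih i ((termSize_lt_func f (fun i => (ts i).subst τ) i).trans ha)

variable {s t : L.Term V} {τ : V → L.Term V}

/-- The size guard in the recursion is inert when `τ` is a unifier: a representative `f(ts)` of `y`
has `τ`-value `τ y`, so the variables in `ts` have strictly smaller values. -/
theorem unifier_cases (hτ : s.subst τ = t.subst τ) (y : V) :
    haveI : Nonempty (L.Term V) := ⟨s⟩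
    (∃ z, pickTerm {b | Identified s t (.var y) b} = .var z ∧ unifier s t τ y = .var z) ∨
      ∃ l, ∃ (f : L.Functions l) (ts : Fin l → L.Term V),
        pickTerm {b | Identified s t (.var y) b} = .func f ts ∧
        unifier s t τ y = .func f fun i => (ts i).subst (unifier s t τ) := by
  have : Nonempty (L.Term V) := ⟨s⟩
  have hmem : Identified s t (.var y) (pickTerm {b | Identified s t (.var y) b}) :=
    pickTerm_mem (S := {b | Identified s t (.var y) b}) ⟨.var y, fun _ _ => rfl⟩
  rw [unifier]
  cases h : pickTerm {b | Identified s t (.var y) b} with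
  | var z => exact .inl ⟨z, rfl, rfl⟩
  | func f ts =>
    refine .inr ⟨_, f, ts, rfl, ?_⟩
    simp only
    congr 1
    funext i
    refine subst_ite_of_termSize_lt τ _ _ _ ?_
    have : τ y = (Term.func f ts).subst τ := by rw [← h]; exact hmem τ hτ
    rw [this]
    exact termSize_lt_func f (fun i => (ts i).subst τ) i

/-- This gives most generality: every unifier `τ'` equals `unifier s t τ` followed by `τ'` itself.
The induction on the `τ`-size works because representatives keep that size and arguments decrease
it. -/
theorem identified_subst_unifier (hτ : s.subst τ = t.subst τ) (a : L.Term V) :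
    Identified s t (a.subst (unifier s t τ)) a := by
  have : Nonempty (L.Term V) := ⟨s⟩
  induction hn : termSize (a.subst τ) using Nat.strong_induction_on generalizing a with
  | _ n ih =>
  have hfunc : ∀ {l} (f : L.Functions l) (ts : Fin l → L.Term V),
      termSize ((Term.func f ts).subst τ) = n →
      Identified s t (.func f fun i => (ts i).subst (unifier s t τ)) (.func f ts) := by
    intro l f ts hl τ' hτ'
    simp only [Term.subst]
    congr 1
    funext i
    exact ih _ (hl ▸ termSize_lt_func f (fun i => (ts i).subst τ) i) (ts i) rfl τ' hτ'
  cases a with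
  | func f ts => exact hfunc f ts hn
  | var y =>
    have hmem : Identified s t (.var y) (pickTerm {b | Identified s t (.var y) b}) :=
      pickTerm_mem (S := {b | Identified s t (.var y) b}) ⟨.var y, fun _ _ => rfl⟩
    intro τ' hτ'
    rcases unifier_cases hτ y with ⟨z, hz, hu⟩ | ⟨l, f, ts, hz, hu⟩ <;>
      simp only [Term.subst, hu] <;> rw [hz] at hmem
    · exact (hmem τ' hτ').symm
    · refine (hfunc f ts ?_ τ' hτ').trans (hmem τ' hτ').symm
      rw [← hn, hmem τ hτ]

/-- Applied to `s` and `t`, this shows that they are unified. Identified variables share a class and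
hence a representative. A variable identified with a compound term has a compound representative,
because `pickTerm` prefers these; that reduces the mixed case to two compound terms with equal head
symbols and identified arguments. -/
theorem Identified.subst_unifier_eq (hτ : s.subst τ = t.subst τ) {a b : L.Term V}
    (hab : Identified s t a b) : a.subst (unifier s t τ) = b.subst (unifier s t τ) := by
  have : Nonempty (L.Term V) := ⟨s⟩
  induction hn : termSize (a.subst τ) using Nat.strong_induction_on generalizing a b with
  | _ n ih =>
  have hfunc : ∀ {l l'} (f : L.Functions l) (ts : Fin l → L.Term V) (g : L.Functions l')
      (us : Fin l' → L.Term V), termSize ((Term.func f ts).subst τ) = n →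
      Identified s t (.func f ts) (.func g us) →
      (Term.func f fun i => (ts i).subst (unifier s t τ)) =
        .func g fun i => (us i).subst (unifier s t τ) := by
    intro l l' f ts g us hl hfg
    have h := hfg τ hτ
    simp only [Term.subst, Term.func.injEq] at h
    obtain ⟨rfl, hf, -⟩ := h
    cases hf
    congr 1
    funext i
    refine ih _ (hl ▸ termSize_lt_func f (fun i => (ts i).subst τ) i) (fun τ' hτ' => ?_) rfl
    have h := hfg τ' hτ'
    simp only [Term.subst, Term.func.injEq, heq_eq_eq, true_and] at h
    exact congrFun h i
  have hvar : ∀ {l} (y : V) (g : L.Functions l) (us : Fin l → L.Term V),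
      termSize (τ y) = n → Identified s t (.var y) (.func g us) →
      unifier s t τ y = .func g fun i => (us i).subst (unifier s t τ) := by
    intro l y g us hl hyg
    have hmem : Identified s t (.var y) (pickTerm {b | Identified s t (.var y) b}) :=
      pickTerm_mem (S := {b | Identified s t (.var y) b}) ⟨.var y, fun _ _ => rfl⟩
    obtain ⟨l', f', ts', h'⟩ := exists_pickTerm_eq_func (S := {b | Identified s t (.var y) b}) hyg
    rcases unifier_cases hτ y with ⟨z, hz, hu⟩ | ⟨l, f, ts, hz, hu⟩
    · cases hz.symm.trans h'
    · rw [hz] at hmem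
      rw [hu]
      refine hfunc f ts g us ?_ fun τ' hτ' => (hmem τ' hτ').symm.trans (hyg τ' hτ')
      rw [← hl, ← hmem τ hτ]
      rfl
  cases a with
  | func f ts =>
    cases b with
    | func g us => exact hfunc f ts g us hn hab
    | var z =>
      refine (hvar z f ts ?_ fun τ' hτ' => (hab τ' hτ').symm).symm
      rw [← hn, hab τ hτ]
      rfl
  | var y =>
    cases b with
    | func g us => exact hvar y g us hn hab
    | var z =>
      have hS : {b | Identified s t (.var y) b} = {b | Identified s t (.var z) b} :=
        Set.ext fun c => ⟨fun h τ' hτ' => (hab τ' hτ').symm.trans (h τ' hτ'),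
          fun h τ' hτ' => (hab τ' hτ').trans (h τ' hτ')⟩
      simp only [Term.subst]
      rcases unifier_cases hτ y with ⟨y', hy, hu⟩ | ⟨l, f, ts, hy, hu⟩ <;>
      rcases unifier_cases hτ z with ⟨z', hz, hu'⟩ | ⟨l', f', ts', hz, hu'⟩ <;>
      rw [hS, hz] at hy <;> cases hy <;> rw [hu, hu']

/-- Unifiable terms have a most general unifier. -/
theorem exists_isMGU (hτ : s.subst τ = t.subst τ) : ∃ μ, IsMGU μ s t :=
  ⟨unifier s t τ, Identified.subst_unifier_eq hτ fun _ h => h, fun τ' hτ' =>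
    ⟨τ', funext fun y => (identified_subst_unifier hτ (.var y) τ' hτ').symm⟩⟩

end Unification

/-! ### Steps, conversions and peaks -/

section Peaks

open FirstOrder.Language Relation

variable {L : FirstOrder.Language.{u, v}} {V : Type w} {R : Set (Rule L V)}

theorem exists_ctx_of_subtermAt : ∀ (t : L.Term V) (p : List ℕ) (s : L.Term V),
    subtermAt t p = some s → ∃ C : Ctx L V, C.holePos = p ∧ C.fill s = t
  | t, [], s, h => by
      have : t = s := by cases t <;> simpa [subtermAt] using h
      exact ⟨.hole, rfl, this.symm⟩
  | .var _, _ :: _, _, h => by simp [subtermAt] at h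
  | @Term.func _ _ l f ts, i :: p, s, h => by
      by_cases hi : i < l
      · simp only [subtermAt, hi, dif_pos] at h
        obtain ⟨C, hC, hs⟩ := exists_ctx_of_subtermAt _ p s h
        exact ⟨.func f ts ⟨i, hi⟩ C, by simp [Ctx.holePos, hC], by simp [Ctx.fill, hs]⟩
      · simp [subtermAt, hi] at h

theorem subtermAt_nil (t : L.Term V) : subtermAt t [] = some t := by
  cases t <;> rfl

theorem replaceAt_nil (t r : L.Term V) : replaceAt t [] r = r := by
  cases t <;> rfl

theorem Step.rewrites (e : Step R) : Rewrites R e.source e.target := by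
  obtain ⟨C, hC, hs⟩ := exists_ctx_of_subtermAt _ _ _ e.source_at
  have ht : e.target = C.fill (e.rule.rhs.subst e.sub) := by
    have := replaceAt_fill C (e.rule.lhs.subst e.sub) (e.rule.rhs.subst e.sub) []
    rwa [List.append_nil, hs, hC, replaceAt_nil] at this
  rw [ht, ← hs]
  exact .ctx C (.subst _ (.rule _ e.rule_mem))

theorem Step.inst_hole_var (e : Step R) : e.inst .hole Term.var = e := by
  refine Step.ext (subst_var _) rfl rfl ?_
  funext y
  exact subst_var _

theorem Rewrites.exists_step {s t : L.Term V} (h : Rewrites R s t) :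
    ∃ e : Step R, e.source = s ∧ e.target = t := by
  induction h with
  | rule ρ hρ =>
    refine ⟨⟨ρ.lhs, [], ρ, Term.var, hρ, ?_⟩, rfl, ?_⟩
    · rw [subtermAt_nil, subst_var]
    · simp only [Step.target]
      rw [replaceAt_nil, subst_var]
  | subst σ _ ih =>
    obtain ⟨e, rfl, rfl⟩ := ih
    exact ⟨e.inst .hole σ, rfl, e.inst_target .hole σ⟩
  | ctx C _ ih =>
    obtain ⟨e, rfl, rfl⟩ := ih
    refine ⟨e.inst C Term.var, ?_, ?_⟩
    · simp only [Step.inst, subst_var]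
    · rw [e.inst_target, subst_var]

/-- The peak read from right to left. -/
def LocalPeak.swap (P : LocalPeak R) : LocalPeak R := ⟨P.right, P.left, P.source_eq.symm⟩

/-- A peak whose left step overlaps with the right step, at or below it, is an instance of a
critical peak. -/
theorem LocalPeak.exists_critical [Infinite V] (P : LocalPeak R) {q : List ℕ}
    (hpos : P.left.pos = P.right.pos ++ q) (hq : IsFunPos P.right.rule.lhs q) :
    ∃ (Q : LocalPeak R) (C : Ctx L V) (θ : V → L.Term V), Q.IsCritical ∧
      Q.left.inst C θ = P.left ∧ Q.right.inst C θ = P.right := by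
  obtain ⟨e₁, e₂, hsrc⟩ := P
  dsimp only at hpos hq ⊢
  obtain ⟨l, f, ts, hw⟩ := hq
  obtain ⟨C, hC, hs⟩ := exists_ctx_of_subtermAt _ _ _ e₂.source_at
  -- For infinite `V`, a bijection from `V ⊕ V` yields two injective renamings with disjoint ranges
  -- covering `V`. The substitutions of both steps then glue to one unifier `τ`, which factors
  -- through the most general one.
  obtain ⟨ι⟩ : Nonempty (V ⊕ V ≃ V) :=
    Cardinal.eq.1 (by rw [Cardinal.mk_sum, Cardinal.lift_id,
      Cardinal.add_eq_self (Cardinal.aleph0_le_mk V)])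
  set ρ₁ : V → V := fun y => ι (.inl y)
  set ρ₂ : V → V := fun y => ι (.inr y)
  set τ : V → L.Term V := fun y => Sum.elim e₁.sub e₂.sub (ι.symm y)
  have hτ₁ : (fun y => τ (ρ₁ y)) = e₁.sub := by funext y; simp [τ, ρ₁]
  have hτ₂ : (fun y => τ (ρ₂ y)) = e₂.sub := by funext y; simp [τ, ρ₂]
  have hw₂ : ∀ μ : V → L.Term V, subtermAt (e₂.rule.lhs.subst fun y => μ (ρ₂ y)) q =
      some ((Term.func f ts).subst fun y => μ (ρ₂ y)) :=
    fun μ => subtermAt_subst _ _ _ _ hw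
  have hsub : (Term.func f ts).subst e₂.sub = e₁.rule.lhs.subst e₁.sub := by
    have h := e₁.source_at
    rw [hsrc, hpos, ← hs, ← hC, subtermAt_fill, subtermAt_subst _ _ _ _ hw] at h
    exact Option.some.inj h
  have hunif : (e₁.rule.lhs.relabel ρ₁).subst τ = ((Term.func f ts).relabel ρ₂).subst τ := by
    rw [relabel_subst, relabel_subst, hτ₁, hτ₂, hsub]
  obtain ⟨μ, hμ⟩ := exists_isMGU hunif
  obtain ⟨θ, hθ⟩ := hμ.2 τ hunif
  have hμ' := hμ.1
  rw [relabel_subst, relabel_subst] at hμ'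
  have hθ' : ∀ y, τ y = (μ y).subst θ := fun y => congrFun hθ y
  have hrelabel : e₂.rule.lhs.relabel ρ₂ = e₂.rule.lhs.subst fun y => .var (ρ₂ y) := by
    have := relabel_subst e₂.rule.lhs ρ₂ Term.var
    rwa [subst_var] at this
  have hθ₁ : substComp (fun y => μ (ρ₁ y)) θ = e₁.sub := by
    rw [← hτ₁]; funext y; exact (hθ' _).symm
  have hθ₂ : substComp (fun y => μ (ρ₂ y)) θ = e₂.sub := by
    rw [← hτ₂]; funext y; exact (hθ' _).symm
  have hsource : C.fill ((e₂.rule.lhs.subst fun y => μ (ρ₂ y)).subst θ) = e₂.source := by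
    rw [subst_subst, hθ₂, hs]
  refine ⟨⟨⟨e₂.rule.lhs.subst fun y => μ (ρ₂ y), q, e₁.rule, fun y => μ (ρ₁ y), e₁.rule_mem,
      (hw₂ μ).trans (congrArg some hμ'.symm)⟩,
    ⟨e₂.rule.lhs.subst fun y => μ (ρ₂ y), [], e₂.rule, fun y => μ (ρ₂ y), e₂.rule_mem,
      subtermAt_nil _⟩, rfl⟩, C, θ, ?_, ?_, ?_⟩
  · refine ⟨ρ₁, ρ₂, μ, (Term.func f ts).relabel ρ₂, ?_, ?_, ?_, ⟨l, f, ts, hw⟩, ?_, hμ, rfl,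
      rfl, rfl⟩
    · exact ι.injective.comp Sum.inl_injective
    · exact ι.injective.comp Sum.inr_injective
    · rw [Set.disjoint_left]
      rintro _ ⟨y, rfl⟩ ⟨z, hz⟩
      cases ι.injective hz
    · dsimp only
      rw [hrelabel, ← subst_var ((Term.func f ts).relabel ρ₂), relabel_subst]
      exact hw₂ Term.var
  · exact Step.ext (hsource.trans hsrc.symm) ((congrArg (· ++ q) hC).trans hpos.symm) rfl hθ₁
  · exact Step.ext hsource ((List.append_nil _).trans hC) rfl hθ₂

end Peaks

/-! ### From labelings to decreasing diagrams -/

section Labelings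

open FirstOrder.Language Relation

variable {L : FirstOrder.Language.{u, v}} {V : Type w} {R : Set (Rule L V)} {Λ : Type x}
  {gt ge : Λ → Λ → Prop} {lab : OStep R → Λ}

/-- There is a step from `s` to `t` whose label has rank at most `c`. -/
def StepRank (rk : Λ → Ordinal.{x}) (lab : OStep R → Λ) (c : Ordinal.{x}) (s t : L.Term V) : Prop :=
  ∃ e : Step R, e.source = s ∧ e.target = t ∧ rk (lab (.fwd e)) ≤ c

/-- The unoriented step underlying an oriented step. -/
def OStep.step : OStep R → Step R
  | .fwd e => e
  | .bwd e => e

theorem IsLabeling.lab_eq (hlab : IsLabeling gt ge lab) (o : OStep R) :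
    lab o = lab (.fwd o.step) := by
  cases o with
  | fwd e => rfl
  | bwd e => exact (hlab.fwd_eq_bwd e).symm

theorem IsConversion.convBelow_inst {rk : Λ → Ordinal.{x}} {s t : L.Term V} {c : List (OStep R)}
    (h : IsConversion R s c t) (C : Ctx L V) (θ : V → L.Term V) {a : Ordinal.{x}}
    (ha : ∀ o ∈ c, rk (lab (.fwd (o.step.inst C θ))) < a) :
    ConvBelow (StepRank rk lab) a (C.fill (s.subst θ)) (C.fill (t.subst θ)) := by
  induction h with
  | nil s => exact .refl _ _
  | cons o _ ih =>
    refine ReflTransGen.head ?_ (ih fun o' ho' => ha o' (List.mem_cons_of_mem _ ho'))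
    have ho := ha o List.mem_cons_self
    cases o with
    | fwd e => exact .inl ⟨_, ho, e.inst C θ, rfl, e.inst_target C θ, le_rfl⟩
    | bwd e => exact .inr ⟨_, ho, e.inst C θ, rfl, e.inst_target C θ, le_rfl⟩

/-- Instances of extended locally decreasing peaks are joined by decreasing diagrams. -/
theorem LocalPeak.IsELD.decreasingJoin_inst {rk : Λ → Ordinal.{x}}
    (hgt : ∀ α β, gt α β → rk β < rk α) (hge : ∀ α β, ge α β → rk β ≤ rk α)
    (hlab : IsLabeling gt ge lab) {P : LocalPeak R} (hP : P.IsELD gt ge lab) (C : Ctx L V)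
    (θ : V → L.Term V) {a b : Ordinal.{x}} (ha : rk (lab (.fwd (P.left.inst C θ))) ≤ a)
    (hb : rk (lab (.fwd (P.right.inst C θ))) ≤ b) :
    DecreasingJoin (StepRank rk lab) a b (P.left.inst C θ).target (P.right.inst C θ).target := by
  obtain ⟨t', t'', u'', u', c₁, c₂, c₃, c₄, c₅, h₁, h₂, h₃, h₄, h₅, l₁, l₂, l₃, l₄, l₅⟩ := hP
  -- The comparison is transferred to the instances before passing to ranks: preservation under
  -- instances is known for `gt` and `ge`, not for the order of ranks.
  have hgt' : ∀ (o o' : OStep R), gt (lab o) (lab o') →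
      rk (lab (.fwd (o'.step.inst C θ))) < rk (lab (.fwd (o.step.inst C θ))) := by
    intro o o' h
    rw [hlab.lab_eq o, hlab.lab_eq o'] at h
    exact hgt _ _ (hlab.gt_inst _ _ C θ h)
  have hge' : ∀ (o o' : OStep R), ge (lab o) (lab o') →
      rk (lab (.fwd (o'.step.inst C θ))) ≤ rk (lab (.fwd (o.step.inst C θ))) := by
    intro o o' h
    rw [hlab.lab_eq o, hlab.lab_eq o'] at h
    exact hge _ _ (hlab.ge_inst _ _ C θ h)
  have hbound : ∀ {S : Λ → Λ → Prop} {c d : List (OStep R)},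
      labels lab c ⊆ below S (labels lab d) → ∀ o ∈ c, ∃ o' ∈ d, S (lab o') (lab o) := by
    intro S c d h o ho
    obtain ⟨_, ⟨o', ho', rfl⟩, h'⟩ := h ⟨o, ho, rfl⟩
    exact ⟨o', ho', h'⟩
  rw [Step.inst_target, Step.inst_target]
  refine ⟨C.fill (t'.subst θ), C.fill (t''.subst θ), C.fill (u''.subst θ), C.fill (u'.subst θ),
    h₁.convBelow_inst C θ ?_, ?_, h₃.convBelow_inst C θ ?_, ?_, h₅.convBelow_inst C θ ?_⟩
  · intro o ho
    obtain ⟨o', ho', h⟩ := hbound l₁ o ho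
    obtain rfl := List.mem_singleton.1 ho'
    exact (hgt' _ _ h).trans_le ha
  · rcases h₂ with ⟨-, rfl⟩ | ⟨e, rfl, rfl, rfl⟩
    · exact .refl
    · obtain ⟨o', ho', h⟩ := hbound l₂ (.fwd e) List.mem_cons_self
      obtain rfl := List.mem_singleton.1 ho'
      exact .single ⟨e.inst C θ, rfl, e.inst_target C θ, (hge' _ _ h).trans hb⟩
  · intro o ho
    obtain ⟨o', ho', h⟩ := hbound l₃ o ho
    rcases List.mem_cons.1 ho' with rfl | ho'
    · exact (hgt' _ _ h).trans_le (ha.trans (le_max_left _ _))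
    · obtain rfl := List.mem_singleton.1 ho'
      exact (hgt' _ _ h).trans_le (hb.trans (le_max_right _ _))
  · rcases h₄ with ⟨-, rfl⟩ | ⟨e, rfl, rfl, rfl⟩
    · exact .refl
    · obtain ⟨o', ho', h⟩ := hbound l₄ (.bwd e) List.mem_cons_self
      obtain rfl := List.mem_singleton.1 ho'
      exact .single ⟨e.inst C θ, rfl, e.inst_target C θ, (hge' _ _ h).trans ha⟩
  · intro o ho
    obtain ⟨o', ho', h⟩ := hbound l₅ o ho
    obtain rfl := List.mem_singleton.1 ho'
    exact (hgt' _ _ h).trans_le hb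

/-- If all parallel, variable and critical peaks are extended locally decreasing, then all local
peaks are joined by decreasing diagrams. -/
theorem LocalPeak.decreasingJoin [Infinite V] {rk : Λ → Ordinal.{x}}
    (hgt : ∀ α β, gt α β → rk β < rk α) (hge : ∀ α β, ge α β → rk β ≤ rk α)
    (hlab : IsLabeling gt ge lab) (hcomp : IsCompatible gt ge lab)
    (hcrit : ∀ P : LocalPeak R, P.IsCritical → P.IsELD gt ge lab) (P : LocalPeak R)
    {a b : Ordinal.{x}} (ha : rk (lab (.fwd P.left)) ≤ a) (hb : rk (lab (.fwd P.right)) ≤ b) :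
    DecreasingJoin (StepRank rk lab) a b P.left.target P.right.target := by
  have hELD : ∀ (P : LocalPeak R) {a b : Ordinal.{x}}, P.IsELD gt ge lab →
      rk (lab (.fwd P.left)) ≤ a → rk (lab (.fwd P.right)) ≤ b →
      DecreasingJoin (StepRank rk lab) a b P.left.target P.right.target := by
    intro P a b h ha hb
    have := h.decreasingJoin_inst hgt hge hlab .hole Term.var (a := a) (b := b)
    simp only [Step.inst_hole_var] at this
    exact this ha hb
  have hbelow : ∀ (P : LocalPeak R) {a b : Ordinal.{x}}, P.right.pos <+: P.left.pos →
      rk (lab (.fwd P.left)) ≤ a → rk (lab (.fwd P.right)) ≤ b →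
      DecreasingJoin (StepRank rk lab) a b P.left.target P.right.target := by
    rintro P a b ⟨q, hq⟩ ha hb
    by_cases hfun : IsFunPos P.right.rule.lhs q
    · obtain ⟨Q, C, θ, hQ, h₁, h₂⟩ := P.exists_critical hq.symm hfun
      rw [← h₁] at ha ⊢
      rw [← h₂] at hb ⊢
      exact (hcrit Q hQ).decreasingJoin_inst hgt hge hlab C θ ha hb
    · exact hELD P (hcomp P (.inr ⟨q, hq.symm, hfun⟩)) ha hb
  by_cases h₁ : P.right.pos <+: P.left.pos
  · exact hbelow P h₁ ha hb
  by_cases h₂ : P.left.pos <+: P.right.pos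
  · exact (hbelow P.swap h₂ hb ha).symm
  · exact hELD P (hcomp P (.inl ⟨h₂, h₁⟩)) ha hb

theorem exists_convBelow_of_rewrites (rk : Λ → Ordinal.{x}) (lab : OStep R → Λ) {s t : L.Term V}
    (h : ReflTransGen (Rewrites R) s t) : ∃ c, ConvBelow (StepRank rk lab) c s t := by
  induction h with
  | refl => exact ⟨0, .refl _ _⟩
  | tail _ hs ih =>
    obtain ⟨c, hc⟩ := ih
    obtain ⟨e, rfl, rfl⟩ := hs.exists_step
    -- The successor is needed because the bound on indices is strict.
    refine ⟨max c (Order.succ (rk (lab (.fwd e)))), (hc.mono (le_max_left _ _)).trans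
      (.single (.inl ⟨_, ?_, e, rfl, rfl, le_rfl⟩))⟩
    exact (Order.lt_succ _).trans_le (le_max_right _ _)

theorem rewrites_of_redBelow {rk : Λ → Ordinal.{x}} {c : Ordinal.{x}} {s t : L.Term V}
    (h : RedBelow (StepRank rk lab) c s t) : ReflTransGen (Rewrites R) s t := by
  refine ReflTransGen.mono ?_ _ _ h
  rintro _ _ ⟨_, -, e, rfl, rfl, -⟩
  exact e.rewrites

end Labelings

end Rewriting

/-! ### Confluence via the ranks of labels -/

theorem mainTheorem3 {L : FirstOrder.Language.{u, v}} {V : Type w} [Infinite V]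
    (R : Set (Rewriting.Rule L V)) {Λ : Type x}
    (gt ge : Λ → Λ → Prop)
    (gt_trans : ∀ α β γ : Λ, gt α β → gt β γ → gt α γ)
    (gt_wf : WellFounded (fun α β : Λ => gt β α))
    (ge_refl : ∀ α : Λ, ge α α)
    (ge_trans : ∀ α β γ : Λ, ge α β → ge β γ → ge α γ)
    (compat : ∀ α β γ δ : Λ, ge α β → gt β γ → ge γ δ → gt α δ)
    (lab : Rewriting.OStep R → Λ)
    (hlab : Rewriting.IsLabeling gt ge lab)
    (hcomp : Rewriting.IsCompatible gt ge lab)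
    (hcrit : ∀ P : Rewriting.LocalPeak R, P.IsCritical → P.IsELD gt ge lab) :
    Rewriting.Confluent R := by
  have : IsWellFounded Λ (fun α β : Λ => gt β α) := ⟨gt_wf⟩
  let rk : Λ → Ordinal.{x} := IsWellFounded.rank (fun α β : Λ => gt β α)
  have hgt : ∀ α β, gt α β → rk β < rk α := fun α β h => IsWellFounded.rank_lt_of_rel h
  have hge : ∀ α β, ge α β → rk β ≤ rk α := by
    intro α β h
    simp only [rk]
    rw [IsWellFounded.rank_eq (fun α β : Λ => gt β α) β]
    -- Any `γ` below `β` is below `α` by `compat`, so `rk α` bounds every successor in the supremum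
    -- defining `rk β`.
    exact Ordinal.iSup_le fun γ => Order.succ_le_of_lt (hgt α γ (compat α β γ γ h γ.2 (ge_refl _)))
  have hr : ∀ a b s t u, Rewriting.StepRank rk lab a s t → Rewriting.StepRank rk lab b s u →
      Rewriting.DecreasingJoin (Rewriting.StepRank rk lab) a b t u := by
    rintro a b s _ _ ⟨e₁, rfl, rfl, h₁⟩ ⟨e₂, hs, rfl, h₂⟩
    exact Rewriting.LocalPeak.decreasingJoin hgt hge hlab hcomp hcrit ⟨e₁, e₂, hs.symm⟩ h₁ h₂
  intro s t u ht hu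
  obtain ⟨c, hc⟩ := Rewriting.exists_convBelow_of_rewrites rk lab ht
  obtain ⟨d, hd⟩ := Rewriting.exists_convBelow_of_rewrites rk lab hu
  obtain ⟨z, h₁, h₂⟩ := Rewriting.joinable_of_convBelow Ordinal.lt_wf hr
    ((hc.mono (le_max_left c d)).symm.trans (hd.mono (le_max_right c d)))
  exact ⟨z, Rewriting.rewrites_of_redBelow h₁, Rewriting.rewrites_of_redBelow h₂⟩
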